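/- Let $k$ be an algebraically closed field, and let $A = kQ_A/I_A$ and $B = kQ_B/I_B$ be bound quiver algebras, where $Q_A$, $Q_B$ are finite connected quivers and $I_A$, $I_B$ are admissible ideals of the path algebras $kQ_A$, $kQ_B$. Suppose that the underlying graph of $Q_A$ and the underlying graph of $Q_B$ both contain a cycle. Here the underlying graph is the multigraph obtained by forgetting the directions of the arrows; a cycle consists of $n \ge 1$ distinct vertices $x_1,\dots,x_n$ and $n$ distinct arrows $e_1,\dots,e_n$ such that $e_i$ joins $x_i$ and $x_{i+1}$ in one of the two directions (with $x_{n+1} = x_1$), so that loops ($n=1$) and pairs of distinct parallel or opposite arrows between two vertices ($n=2$) count as cycles. Then the $k$-algebra $A \otimes_k B$ is representation-infinite, that is, there are infinitely many isomorphism classes of finite-dimensional indecomposable $(A\otimes_k B)$-modules. -/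

import Mathlib

universe u v w v₁ w₁ v₂ w₂

/-- A path of the quiver `V`, of any length `≥ 0`, together with its two end points. -/
structure QuiverPath (V : Type v) [Quiver.{w} V] where
  source : V
  target : V
  path : Quiver.Path source target

/-- The underlying vector space of the path algebra: the paths of the quiver form a basis. -/
def PathAlgebra (k : Type u) (V : Type v) [Field k] [Quiver.{w} V] :=
  QuiverPath V →₀ k

namespace PathAlgebra

section Basic

variable (k : Type u) {V : Type v} [Field k] [Quiver.{w} V]

noncomputable instance : AddCommGroup (PathAlgebra k V) :=
  inferInstanceAs (AddCommGroup (QuiverPath V →₀ k))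

noncomputable instance : Module k (PathAlgebra k V) :=
  inferInstanceAs (Module k (QuiverPath V →₀ k))

/-- A path, as an element of the path algebra. -/
noncomputable def ofPath (p : QuiverPath V) : PathAlgebra k V :=
  Finsupp.single p 1

/-- The paths, as a basis of the path algebra. -/
noncomputable def pathBasis : Module.Basis (QuiverPath V) k (PathAlgebra k V) :=
  ⟨LinearEquiv.refl k (QuiverPath V →₀ k)⟩

theorem pathBasis_apply (p : QuiverPath V) : pathBasis k p = ofPath k p := rfl

open Classical in
/-- The product of two paths `p` and `q`: their concatenation "first `p`, then `q`" if `p` ends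
where `q` starts, and zero otherwise. -/
noncomputable def mulPath (p q : QuiverPath V) : PathAlgebra k V :=
  if h : p.target = q.source then
    ofPath k ⟨p.source, q.target, (p.path.cast rfl h).comp q.path⟩
  else 0

/-- The bilinear extension of the product of paths. -/
noncomputable def mulLin : PathAlgebra k V →ₗ[k] PathAlgebra k V →ₗ[k] PathAlgebra k V :=
  (pathBasis k).constr k fun p => (pathBasis k).constr k fun q => mulPath k p q

noncomputable instance : Mul (PathAlgebra k V) := ⟨fun x y => mulLin k x y⟩

theorem mul_def (x y : PathAlgebra k V) : x * y = mulLin k x y := rfl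

theorem ofPath_mul_ofPath (p q : QuiverPath V) :
    ofPath k p * ofPath k q = mulPath k p q := by
  rw [mul_def, mulLin, ← pathBasis_apply, ← pathBasis_apply, Module.Basis.constr_basis,
    Module.Basis.constr_basis]

theorem mulPath_comp {a b c : V} (p : Quiver.Path a b) (q : Quiver.Path b c) :
    mulPath k ⟨a, b, p⟩ ⟨b, c, q⟩ = ofPath k ⟨a, c, p.comp q⟩ := by
  simp [mulPath]

theorem mulPath_of_ne (p q : QuiverPath V) (h : p.target ≠ q.source) : mulPath k p q = 0 := by
  simp [mulPath, h]

theorem mulPath_assoc (p q r : QuiverPath V) :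
    mulPath k p q * ofPath k r = ofPath k p * mulPath k q r := by
  obtain ⟨a, b, p⟩ := p
  obtain ⟨c, d, q⟩ := q
  obtain ⟨e, f, r⟩ := r
  by_cases h : b = c
  · subst h
    by_cases h' : d = e
    · subst h'
      simp only [mulPath_comp, ofPath_mul_ofPath, Quiver.Path.comp_assoc]
    · rw [mulPath_comp, ofPath_mul_ofPath, mulPath_of_ne _ _ _ h', mulPath_of_ne _ _ _ h',
        mul_def, map_zero]
  · rw [mulPath_of_ne _ _ _ h, mul_def, map_zero, LinearMap.zero_apply]
    by_cases h' : d = e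
    · subst h'
      rw [mulPath_comp, ofPath_mul_ofPath, mulPath_of_ne _ _ _ h]
    · rw [mulPath_of_ne _ _ _ h', mul_def, map_zero]

/-- The trivial path at a vertex, an idempotent of the path algebra. -/
noncomputable def idem (a : V) : PathAlgebra k V := ofPath k ⟨a, a, Quiver.Path.nil⟩

/-- An arrow, as an element of the path algebra. -/
noncomputable def arrow (e : Quiver.Total V) : PathAlgebra k V :=
  ofPath k ⟨e.left, e.right, e.hom.toPath⟩

theorem idem_mul_ofPath_self (p : QuiverPath V) :
    idem k p.source * ofPath k p = ofPath k p := by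
  obtain ⟨a, b, p⟩ := p
  rw [idem, ofPath_mul_ofPath, mulPath_comp, Quiver.Path.nil_comp]

theorem ofPath_mul_idem_self (p : QuiverPath V) :
    ofPath k p * idem k p.target = ofPath k p := by
  obtain ⟨a, b, p⟩ := p
  rw [idem, ofPath_mul_ofPath, mulPath_comp, Quiver.Path.comp_nil]

theorem idem_mul_ofPath_of_ne (a : V) (p : QuiverPath V) (h : a ≠ p.source) :
    idem k a * ofPath k p = 0 := by
  rw [idem, ofPath_mul_ofPath, mulPath_of_ne _ _ _ h]

theorem ofPath_mul_idem_of_ne (a : V) (p : QuiverPath V) (h : p.target ≠ a) :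
    ofPath k p * idem k a = 0 := by
  rw [idem, ofPath_mul_ofPath, mulPath_of_ne _ _ _ h]

theorem assoc_lin (x y z : PathAlgebra k V) : x * y * z = x * (y * z) := by
  have h : (LinearMap.llcomp k _ _ _ (mulLin k (V := V)) ∘ₗ mulLin k (V := V)) =
      (LinearMap.lcomp k _ (mulLin k (V := V))) ∘ₗ
        ((LinearMap.llcomp k _ _ _) ∘ₗ mulLin k (V := V)) := by
    refine (pathBasis k).ext fun p => (pathBasis k).ext fun q => (pathBasis k).ext fun r => ?_
    have := mulPath_assoc k p q r
    rw [← ofPath_mul_ofPath, ← ofPath_mul_ofPath] at this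
    exact this
  exact congrArg (fun f => f x y z) h

end Basic

section Ring

variable (k : Type u) (V : Type v) [Field k] [Quiver.{w} V] [Fintype V]

/-- The unit of the path algebra: the sum of the trivial paths. -/
noncomputable instance : One (PathAlgebra k V) := ⟨∑ a : V, idem k a⟩

theorem one_def : (1 : PathAlgebra k V) = ∑ a : V, idem k a := rfl

theorem one_mul_lin (x : PathAlgebra k V) : 1 * x = x := by
  have h : mulLin k (1 : PathAlgebra k V) = LinearMap.id := by
    refine (pathBasis k).ext fun p => ?_
    rw [one_def, map_sum, LinearMap.sum_apply, pathBasis_apply, LinearMap.id_apply,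
      Finset.sum_eq_single p.source]
    · exact idem_mul_ofPath_self k p
    · exact fun b _ hb => idem_mul_ofPath_of_ne k b p hb
    · simp
  exact congrArg (fun f => f x) h

theorem mul_one_lin (x : PathAlgebra k V) : x * 1 = x := by
  have h : (mulLin k).flip (1 : PathAlgebra k V) = LinearMap.id := by
    refine (pathBasis k).ext fun p => ?_
    rw [one_def, map_sum, LinearMap.sum_apply, pathBasis_apply, LinearMap.id_apply,
      Finset.sum_eq_single p.target]
    · exact ofPath_mul_idem_self k p
    · exact fun b _ hb => ofPath_mul_idem_of_ne k b p hb.symm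
    · simp
  exact congrArg (fun f => f x) h

/-- The path algebra of a quiver with finitely many vertices is a ring. -/
noncomputable instance : Ring (PathAlgebra k V) :=
  { (inferInstance : AddCommGroup (PathAlgebra k V)) with
    mul := (· * ·)
    one := 1
    left_distrib := fun x y z => map_add (mulLin k x) y z
    right_distrib := fun x y z => by simp only [mul_def, map_add, LinearMap.add_apply]
    zero_mul := fun x => by simp only [mul_def, map_zero, LinearMap.zero_apply]
    mul_zero := fun x => map_zero (mulLin k x)
    mul_assoc := assoc_lin k
    one_mul := one_mul_lin k V
    mul_one := mul_one_lin k V }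

noncomputable instance : Algebra k (PathAlgebra k V) :=
  Algebra.ofModule
    (fun r x y => by simp only [mul_def, map_smul, LinearMap.smul_apply])
    (fun r x y => by simp only [mul_def, map_smul])

/-- The arrow ideal: the two-sided ideal generated by all arrows. -/
noncomputable def arrowIdeal : Ideal (PathAlgebra k V) :=
  (TwoSidedIdeal.span (Set.range (arrow k (V := V)))).asIdeal

instance : (arrowIdeal k V).IsTwoSided :=
  inferInstanceAs (TwoSidedIdeal.asIdeal _).IsTwoSided

end Ring

/-- A two-sided ideal `I` of the path algebra, with arrow ideal `R`, is admissible if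
`R ^ m ⊆ I ⊆ R ^ 2` for some `m ≥ 2`. -/
structure IsAdmissible {k : Type u} {V : Type v} [Field k] [Quiver.{w} V] [Fintype V]
    (I : Ideal (PathAlgebra k V)) [I.IsTwoSided] : Prop where
  le_sq : I ≤ arrowIdeal k V ^ 2
  pow_le : ∃ m : ℕ, 2 ≤ m ∧ arrowIdeal k V ^ m ≤ I

end PathAlgebra

/-- A quiver is connected if it is nonempty and any two vertices are joined by a walk in the
underlying graph. -/
def QuiverConnected (V : Type v) [Quiver.{w} V] : Prop :=
  Nonempty V ∧ Subsingleton (Quiver.WeaklyConnectedComponent V)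

/-- The underlying graph of the quiver `V` (a multigraph, whose edges are the arrows with their
direction forgotten) contains a cycle: there are `n + 1 ≥ 1` distinct vertices `x 0, …, x n` and
`n + 1` distinct arrows `e 0, …, e n` such that `e i` joins `x i` and `x (i + 1)` in one of the two
directions, where indices are taken modulo `n + 1`. For `n = 0` this is a loop, for `n = 1` it is
a pair of distinct arrows (parallel or opposite) between two vertices. -/
def UnderlyingGraphHasCycle (V : Type v) [Quiver.{w} V] : Prop :=
  ∃ (n : ℕ) (x : Fin (n + 1) → V) (e : Fin (n + 1) → Quiver.Total V),
    Function.Injective x ∧ Function.Injective e ∧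
      ∀ i, ((e i).left = x i ∧ (e i).right = x (i + 1)) ∨
        ((e i).left = x (i + 1) ∧ (e i).right = x i)

/-- A finite-dimensional `k`-algebra `A` is representation-finite if there are only finitely many
isomorphism classes of indecomposable `A`-modules that are finite-dimensional over `k`. It suffices
to look at modules in the universe of `k`, as a finite-dimensional module is isomorphic to one on
the space `k ^ d`. (By the duality `Hom_k(-, k)` it does not matter whether left or right modules
are taken.) -/
def IsRepresentationFinite (k : Type u) (A : Type w) [Field k] [Ring A] [Algebra k A] : Prop :=
  ∃ S : Set (ModuleCat.{u} A), S.Finite ∧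
    ∀ M : ModuleCat.{u} A, Module.Finite k (RestrictScalars k A M) →
      CategoryTheory.Indecomposable M → ∃ N ∈ S, Nonempty (M ≅ N)

/-! Count edges in the separated quiver of the product of two cycles. If the cycles have index sets
`ι` and `κ`, then each `p : ι × κ` is a vertex of the product and labels two arrows, `edge × vert`
and `vert × edge`. Splitting each vertex into a copy `false` and a copy `true`, with all arrows
running between the copies, gives a graph with `2|ι||κ|` vertices and equally many edges. It
therefore carries a nonzero integral flow `z` (`exists_ne_zero_flow`).

Put a line at each separated vertex and let the edge `E` act by a unit `c E`. Composites of two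
arrows vanish, so ideals inside the square of the arrow ideal act by zero, and the two factors
commute (`productRep`). An isomorphism of two such modules rescales the lines (`exists_rescaling`),
hence preserves `∏ E, c E ^ z E` (`prod_zpow_eq_of_flow`). Over an algebraically closed field this
invariant takes every value in `kˣ`, an infinite set, while the dimension stays fixed. Finite
representation type permits only finitely many classes in bounded dimension, so these modules need
not be shown indecomposable. -/

/-! ### Homomorphisms out of path algebras and bound quiver algebras. -/

@[elab_as_elim]
theorem PathAlgebra.path_induction {k : Type u} [Field k] {V : Type v} [Quiver.{w} V]
    {P : PathAlgebra k V → Prop} (x : PathAlgebra k V) (zero : P 0)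
    (add : ∀ x y, P x → P y → P (x + y)) (smul : ∀ (c : k) x, P x → P (c • x))
    (path : ∀ p, P (PathAlgebra.ofPath k p)) : P x := by
  refine Submodule.span_induction (p := fun x _ => P x) ?_ zero (fun x y _ _ => add x y)
    (fun c x _ => smul c x) ((PathAlgebra.pathBasis k).mem_span x)
  rintro _ ⟨p, rfl⟩
  exact path p

/-- A representation of the quiver `V` in a `k`-algebra `C`: orthogonal idempotents with sum `1` for
the vertices, and elements for the arrows, in the corresponding Peirce components. -/
structure QuiverRepIn (V : Type v) [Quiver.{w} V] [Fintype V] (C : Type u) [Ring C] where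
  vert : V → C
  arr : Quiver.Total V → C
  vert_mul_self : ∀ a, vert a * vert a = vert a
  vert_mul_of_ne : ∀ a b, a ≠ b → vert a * vert b = 0
  sum_vert : ∑ a, vert a = 1
  left_mul : ∀ e, vert e.left * arr e = arr e
  mul_right : ∀ e, arr e * vert e.right = arr e

namespace QuiverRepIn

open PathAlgebra

variable {k : Type u} [Field k] {V : Type v} [Quiver.{w} V] [Fintype V]
  {C : Type w₁} [Ring C] [Algebra k C] (F : QuiverRepIn V C)

/-- The value of a path. -/
def onPath {a : V} : {b : V} → Quiver.Path a b → C
  | _, Quiver.Path.nil => F.vert a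
  | _, Quiver.Path.cons p e => onPath p * F.arr ⟨_, _, e⟩

theorem onPath_mul_vert {a b : V} (p : Quiver.Path a b) : F.onPath p * F.vert b = F.onPath p := by
  cases p with
  | nil => exact F.vert_mul_self a
  | cons p e => rw [onPath, mul_assoc, F.mul_right ⟨_, _, e⟩]

theorem vert_mul_onPath {a b : V} (p : Quiver.Path a b) : F.vert a * F.onPath p = F.onPath p := by
  induction p with
  | nil => exact F.vert_mul_self a
  | cons p e ih => rw [onPath, ← mul_assoc, ih]

theorem onPath_comp {a b c : V} (p : Quiver.Path a b) (q : Quiver.Path b c) :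
    F.onPath (p.comp q) = F.onPath p * F.onPath q := by
  induction q with
  | nil => rw [Quiver.Path.comp_nil, onPath, onPath_mul_vert]
  | cons q e ih => rw [Quiver.Path.comp_cons, onPath, onPath, ih, mul_assoc]

theorem onPath_toPath (e : Quiver.Total V) : F.onPath e.hom.toPath = F.arr e :=
  F.left_mul e

variable (k) in
/-- The linear map underlying `QuiverRepIn.lift`. -/
noncomputable def liftLin : PathAlgebra k V →ₗ[k] C :=
  (pathBasis k).constr k fun p => F.onPath p.path

theorem liftLin_ofPath (p : QuiverPath V) : F.liftLin k (ofPath k p) = F.onPath p.path := by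
  rw [liftLin, ← pathBasis_apply, Module.Basis.constr_basis]

theorem liftLin_mul (x y : PathAlgebra k V) :
    F.liftLin k (x * y) = F.liftLin k x * F.liftLin k y := by
  have h : (mulLin k (V := V)).compr₂ (F.liftLin k) =
      (LinearMap.mul k C).compl₁₂ (F.liftLin k) (F.liftLin k) := by
    refine (pathBasis k).ext fun p => (pathBasis k).ext fun q => ?_
    simp only [LinearMap.compr₂_apply, LinearMap.compl₁₂_apply, LinearMap.mul_apply',
      pathBasis_apply, liftLin_ofPath]
    rw [← mul_def, ofPath_mul_ofPath]
    obtain ⟨a, b, p⟩ := p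
    obtain ⟨c, d, q⟩ := q
    by_cases hbc : b = c
    · subst hbc
      rw [mulPath_comp, liftLin_ofPath, onPath_comp]
    · rw [mulPath_of_ne _ _ _ hbc, map_zero]
      dsimp only
      rw [← F.onPath_mul_vert p, ← F.vert_mul_onPath q, mul_assoc, ← mul_assoc (F.vert b),
        F.vert_mul_of_ne b c hbc, zero_mul, mul_zero]
  exact congrArg (fun f => f x y) h

variable (k) in
/-- The algebra homomorphism out of the path algebra given by a quiver representation. -/
noncomputable def lift : PathAlgebra k V →ₐ[k] C :=
  AlgHom.ofLinearMap (F.liftLin k)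
    (by
      rw [one_def, map_sum, ← F.sum_vert]
      exact Finset.sum_congr rfl fun a _ => F.liftLin_ofPath _)
    F.liftLin_mul

theorem lift_ofPath (p : QuiverPath V) : F.lift k (ofPath k p) = F.onPath p.path :=
  F.liftLin_ofPath p

theorem lift_idem (a : V) : F.lift k (idem k a) = F.vert a := F.lift_ofPath _

theorem lift_arrow (e : Quiver.Total V) : F.lift k (arrow k e) = F.arr e := by
  rw [arrow, lift_ofPath, onPath_toPath]

/-- The representation with the same values at the vertices and zero at the arrows. -/
def semisimple : QuiverRepIn V C where
  vert := F.vert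
  arr _ := 0
  vert_mul_self := F.vert_mul_self
  vert_mul_of_ne := F.vert_mul_of_ne
  sum_vert := F.sum_vert
  left_mul _ := mul_zero _
  mul_right _ := zero_mul _

theorem semisimple_lift_eq_zero {x : PathAlgebra k V} (hx : x ∈ arrowIdeal k V) :
    F.semisimple.lift k x = 0 := by
  have h : TwoSidedIdeal.span (Set.range (arrow k (V := V))) ≤
      TwoSidedIdeal.ker (F.semisimple.lift k) := by
    rw [TwoSidedIdeal.span_le]
    rintro _ ⟨e, rfl⟩
    rw [SetLike.mem_coe, TwoSidedIdeal.mem_ker, lift_arrow]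
    rfl
  exact TwoSidedIdeal.mem_ker _ |>.1 (h (TwoSidedIdeal.mem_asIdeal.1 hx))

/-- The two lifts agree on trivial paths; a path of length one contributes its arrow, and longer
paths die because arrows multiply to zero. -/
theorem lift_sub_mem_span (hF : ∀ e e', F.arr e * F.arr e' = 0) (x : PathAlgebra k V) :
    F.lift k x - F.semisimple.lift k x ∈ Submodule.span k (Set.range F.arr) := by
  induction x using path_induction with
  | zero => simp
  | add x y hx hy =>
    rw [map_add, map_add, add_sub_add_comm]
    exact add_mem hx hy
  | smul c x hx =>
    rw [map_smul, map_smul, ← smul_sub]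
    exact Submodule.smul_mem _ _ hx
  | path p =>
    obtain ⟨a, b, p⟩ := p
    rw [lift_ofPath, lift_ofPath]
    cases p with
    | nil => simp [onPath, semisimple]
    | cons p e =>
      simp only [onPath, semisimple, mul_zero, sub_zero]
      cases p with
      | nil =>
        rw [onPath, F.left_mul ⟨_, _, e⟩]
        exact Submodule.subset_span ⟨_, rfl⟩
      | cons p e' => rw [onPath, mul_assoc, hF, mul_zero]; exact zero_mem _

/-- The semisimple lift kills the arrow ideal, so by the comparison above that ideal lands in the
span of the arrow values, a subspace with zero square. -/
theorem lift_eq_zero_of_mem_sq (hF : ∀ e e', F.arr e * F.arr e' = 0) {x : PathAlgebra k V}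
    (hx : x ∈ arrowIdeal k V ^ 2) : F.lift k x = 0 := by
  have key : ∀ x ∈ arrowIdeal k V, F.lift k x ∈ Submodule.span k (Set.range F.arr) := by
    intro x hx
    have := F.lift_sub_mem_span hF x
    rwa [F.semisimple_lift_eq_zero hx, sub_zero] at this
  have hle : arrowIdeal k V ^ 2 ≤ RingHom.ker (F.lift k) := by
    rw [Submodule.pow_succ (n := 1), Submodule.pow_one, Ideal.mul_le]
    intro r hr s hs
    rw [RingHom.mem_ker, map_mul]
    have h0 : Submodule.span k (Set.range F.arr) * Submodule.span k (Set.range F.arr) ≤ ⊥ := by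
      rw [Submodule.mul_le]
      intro x hx y hy
      induction hx, hy using Submodule.span_induction₂ with
      | mem_mem x y hx hy =>
        obtain ⟨e, rfl⟩ := hx
        obtain ⟨e', rfl⟩ := hy
        exact hF e e'
      | zero_left => simp
      | zero_right => simp
      | add_left x y z _ _ _ h1 h2 => rw [add_mul]; exact add_mem h1 h2
      | add_right x y z _ _ _ h1 h2 => rw [mul_add]; exact add_mem h1 h2
      | smul_left r x y _ _ h => rw [smul_mul_assoc]; exact Submodule.smul_mem _ _ h
      | smul_right r x y _ _ h => rw [mul_smul_comm]; exact Submodule.smul_mem _ _ h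
    exact h0 (Submodule.mul_mem_mul (key r hr) (key s hs))
  exact hle hx

/-- The algebra homomorphism out of a bound quiver algebra given by a quiver representation that
vanishes on the paths of length two. -/
noncomputable def liftQuotient (hF : ∀ e e', F.arr e * F.arr e' = 0) (I : Ideal (PathAlgebra k V))
    [I.IsTwoSided] (hI : I ≤ arrowIdeal k V ^ 2) : (PathAlgebra k V ⧸ I) →ₐ[k] C :=
  Ideal.Quotient.liftₐ I (F.lift k) fun _ hx => F.lift_eq_zero_of_mem_sq hF (hI hx)

theorem commute_lift {c : C} (hv : ∀ a, Commute (F.vert a) c) (ha : ∀ e, Commute (F.arr e) c)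
    (x : PathAlgebra k V) : Commute (F.lift k x) c := by
  induction x using path_induction with
  | zero => simp
  | add x y hx hy => rw [map_add]; exact hx.add_left hy
  | smul r x hx => rw [map_smul]; exact hx.smul_left r
  | path p =>
    obtain ⟨a, b, p⟩ := p
    rw [lift_ofPath]
    induction p with
    | nil => exact hv a
    | cons p e ih => exact ih.mul_left (ha _)

end QuiverRepIn

/-! ### Finite representation type and modules of bounded dimension. -/

section FiniteType

open CategoryTheory ModuleCat.Algebra

theorem finrank_eq_add_of_iso_biprod (k : Type u) {Λ : Type w} [Field k] [Ring Λ] [Algebra k Λ]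
    {M : ModuleCat.{u} Λ} {Y Z : ModuleCat.{u} Λ} (f : M ≅ Y ⊞ Z) (hM : Module.Finite k M) :
    Module.Finite k Y ∧ Module.Finite k Z ∧
      Module.finrank k M = Module.finrank k Y + Module.finrank k Z := by
  let g : M ≃ₗ[Λ] (Y × Z) := (f ≪≫ ModuleCat.biprodIsoProd Y Z).toLinearEquiv
  let g' : M ≃ₗ[k] (Y × Z) :=
    { toFun := g
      invFun := g.symm
      left_inv := g.left_inv
      right_inv := g.right_inv
      map_add' := g.map_add
      map_smul' := fun c x => g.map_smul (algebraMap k Λ c) x }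
  have hP : Module.Finite k (Y × Z) := Module.Finite.equiv g'
  have hY : Module.Finite k Y :=
    Module.Finite.of_surjective (LinearMap.fst k _ Z) LinearMap.fst_surjective
  have hZ : Module.Finite k Z :=
    Module.Finite.of_surjective (LinearMap.snd k Y _) LinearMap.snd_surjective
  exact ⟨hY, hZ, by rw [g'.finrank_eq, Module.finrank_prod]⟩

theorem isZero_of_finrank_eq_zero (k : Type u) {Λ : Type w} [Field k] [Ring Λ] [Algebra k Λ]
    {M : ModuleCat.{u} Λ} (hM : Module.Finite k M) (h : Module.finrank k M = 0) :
    Limits.IsZero M := by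
  have : Subsingleton M := Module.finrank_zero_iff.1 h
  exact ModuleCat.isZero_of_subsingleton M

/-- Over a representation-finite algebra, there are only finitely many isomorphism classes of
modules of bounded dimension. -/
theorem IsRepresentationFinite.exists_finite_of_finrank_le {k : Type u} {Λ : Type w} [Field k]
    [Ring Λ] [Algebra k Λ] (h : IsRepresentationFinite k Λ) (d : ℕ) :
    ∃ T : Set (ModuleCat.{u} Λ), T.Finite ∧ ∀ M : ModuleCat.{u} Λ,
      Module.Finite k M → Module.finrank k M ≤ d → ∃ N ∈ T, Nonempty (M ≅ N) := by
  obtain ⟨S, hS, hind⟩ := h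
  induction d with
  | zero =>
    refine ⟨{ModuleCat.of Λ PUnit}, Set.finite_singleton _, fun M hM h0 => ⟨_, rfl, ⟨?_⟩⟩⟩
    exact (isZero_of_finrank_eq_zero k hM (Nat.le_zero.1 h0)).iso
      (ModuleCat.isZero_of_subsingleton _)
  | succ d ih =>
    obtain ⟨T, hT, hTd⟩ := ih
    -- A module of dimension `d + 1` is either indecomposable, hence covered by `S`, or a sum of two
    -- nonzero modules, each of dimension at most `d` and hence covered by `T`.
    refine ⟨T ∪ (S ∪ Set.image2 (fun Y Z => Y ⊞ Z) T T), hT.union (hS.union (hT.image2 _ hT)),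
      fun M hM hd => ?_⟩
    by_cases h0 : Module.finrank k M ≤ d
    · obtain ⟨N, hN, hMN⟩ := hTd M hM h0
      exact ⟨N, Or.inl hN, hMN⟩
    by_cases hI : Indecomposable M
    · obtain ⟨N, hN, hMN⟩ := hind M hM hI
      exact ⟨N, Or.inr (Or.inl hN), hMN⟩
    have hMz : ¬ Limits.IsZero M := by
      intro hz
      have : Subsingleton M := ModuleCat.subsingleton_of_isZero hz
      rw [Module.finrank_zero_of_subsingleton] at h0
      omega
    simp only [Indecomposable, not_and, not_forall, not_or] at hI
    obtain ⟨Y, Z, f, hY, hZ⟩ := hI hMz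
    obtain ⟨fY, fZ, hadd⟩ := finrank_eq_add_of_iso_biprod k f hM
    have hY0 := mt (isZero_of_finrank_eq_zero k fY) hY
    have hZ0 := mt (isZero_of_finrank_eq_zero k fZ) hZ
    obtain ⟨Y', hY', ⟨iY⟩⟩ := hTd Y fY (by omega)
    obtain ⟨Z', hZ', ⟨iZ⟩⟩ := hTd Z fZ (by omega)
    exact ⟨Y' ⊞ Z', Or.inr (Or.inr ⟨Y', hY', Z', hZ', rfl⟩), ⟨f ≪≫ Limits.biprod.mapIso iY iZ⟩⟩

end FiniteType

/-! ### Modules given by matrix representations. -/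

section MatrixModule

open CategoryTheory ModuleCat.Algebra

variable {k : Type u} {Λ : Type w} [Field k] [Ring Λ] [Algebra k Λ]
  {W : Type} [Fintype W] [DecidableEq W]

/-- The module of column vectors of a matrix representation. -/
noncomputable def matrixModule (ρ : Λ →ₐ[k] Matrix W W k) : ModuleCat.{u} Λ :=
  letI : Module Λ (W → k) :=
    Module.compHom (W → k) ((Matrix.toLinAlgEquiv' (R := k) (n := W)).toAlgHom.comp ρ).toRingHom
  ModuleCat.of Λ (W → k)

/-- The space of a matrix representation is the space of column vectors. -/
noncomputable def matrixModuleEquiv (ρ : Λ →ₐ[k] Matrix W W k) :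
    (matrixModule ρ) ≃ₗ[k] (W → k) where
  toFun m := m
  invFun m := m
  left_inv _ := rfl
  right_inv _ := rfl
  map_add' _ _ := rfl
  map_smul' c m := by
    have h : ∀ v : W → k, Matrix.mulVec (ρ (algebraMap k Λ c)) v = c • v := fun v => by
      rw [AlgHom.commutes, Algebra.algebraMap_eq_smul_one, Matrix.smul_mulVec, Matrix.one_mulVec]
    exact h m

theorem exists_intertwiner {ρ ρ' : Λ →ₐ[k] Matrix W W k}
    (h : Nonempty (matrixModule ρ ≅ matrixModule ρ')) :
    ∃ φ : Matrix W W k, IsUnit φ ∧ ∀ x, φ * ρ x = ρ' x * φ := by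
  obtain ⟨f⟩ := h
  let g : matrixModule ρ ≃ₗ[Λ] matrixModule ρ' := f.toLinearEquiv
  let g₁ : (matrixModule ρ) ≃ₗ[k] (matrixModule ρ') :=
    { toFun := g
      invFun := g.symm
      left_inv := g.left_inv
      right_inv := g.right_inv
      map_add' := g.map_add
      map_smul' := fun c x => g.map_smul (algebraMap k Λ c) x }
  let g₂ : (W → k) ≃ₗ[k] (W → k) :=
    (matrixModuleEquiv ρ).symm ≪≫ₗ g₁ ≪≫ₗ matrixModuleEquiv ρ'
  -- By definition `Λ` acts on column vectors through `ρ` and `ρ'`, so this is exactly the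
  -- `Λ`-linearity of `g`.
  have hg : ∀ (x : Λ) (m : W → k), g₂ (Matrix.mulVec (ρ x) m) = Matrix.mulVec (ρ' x) (g₂ m) :=
    fun x m => g.map_smul x m
  have hmv : ∀ m, Matrix.mulVec (LinearMap.toMatrix' (g₂ : (W → k) →ₗ[k] (W → k))) m = g₂ m :=
    fun m => LinearMap.toMatrix'_mulVec _ m
  refine ⟨LinearMap.toMatrix' (g₂ : (W → k) →ₗ[k] (W → k)), ?_, fun x => ?_⟩
  · rw [← Matrix.mulVec_injective_iff_isUnit]
    intro m m' hmm
    simp only [hmv] at hmm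
    exact g₂.injective hmm
  · apply Matrix.toLin'.injective
    ext1 m
    ext1
    simp only [LinearMap.comp_apply, Matrix.toLin'_apply, ← Matrix.mulVec_mulVec, hmv, hg]

end MatrixModule

/-! ### Integral flows and the multiplicative invariant of a weighting. -/

section Weights

variable {W : Type} [Fintype W] [DecidableEq W]

/-- A finite directed graph with as many edges as vertices carries a nonzero integral flow. -/
theorem exists_ne_zero_flow [Nonempty W] (S T : W → W) :
    ∃ z : W → ℤ, z ≠ 0 ∧
      ∀ v, ∑ E, z E * ((if S E = v then 1 else 0) - (if T E = v then 1 else 0)) = 0 := by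
  let N : Matrix W W ℤ :=
    Matrix.of fun v E => (if S E = v then 1 else 0) - (if T E = v then 1 else 0)
  have hdet : N.det = 0 := by
    rw [← Matrix.exists_vecMul_eq_zero_iff]
    -- Each column of the incidence matrix has `+1` at the source and `-1` at the target (cancelling
    -- for a loop), so the all-ones vector is in the left kernel. The matrix is square because edges
    -- and vertices are both indexed by `W`.
    refine ⟨fun _ => 1, fun h => one_ne_zero (congrFun h (Classical.arbitrary W)), ?_⟩
    ext E
    simp [Matrix.vecMul, dotProduct, N, Finset.sum_sub_distrib]
  obtain ⟨z, hz, hNz⟩ := Matrix.exists_mulVec_eq_zero_iff.2 hdet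
  refine ⟨z, hz, fun v => ?_⟩
  have h := congrFun hNz v
  simpa [Matrix.mulVec, dotProduct, N, mul_comm] using h

theorem zpow_sum_eq_prod_zpow {ι G : Type*} [CommGroup G] (g : G) (s : Finset ι) (f : ι → ℤ) :
    g ^ (∑ i ∈ s, f i) = ∏ i ∈ s, g ^ f i := by
  classical
  induction s using Finset.induction_on with
  | empty => simp
  | insert a s ha ih => rw [Finset.sum_insert ha, Finset.prod_insert ha, zpow_add, ih]

/-- The quotient `c' / c` is the coboundary of `g`, and a coboundary pairs trivially with a flow:
collecting the powers of each `g v` gives the exponent zero. -/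
theorem prod_zpow_eq_of_flow {G : Type*} [CommGroup G] {S T : W → W} {z : W → ℤ}
    (hz : ∀ v, ∑ E, z E * ((if S E = v then 1 else 0) - (if T E = v then 1 else 0)) = 0)
    {c c' g : W → G} (h : ∀ E, g (S E) * c E = c' E * g (T E)) :
    ∏ E, c E ^ z E = ∏ E, c' E ^ z E := by
  have h1 : ∀ E, c' E ^ z E / c E ^ z E =
      ∏ v, g v ^ (z E * ((if S E = v then 1 else 0) - (if T E = v then 1 else 0))) := by
    intro E
    have h2 : c' E / c E = g (S E) / g (T E) := by
      rw [div_eq_div_iff_mul_eq_mul, ← h]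
    rw [← div_zpow, h2]
    have h3 : ∀ v, g v ^ (z E * ((if S E = v then 1 else 0) - (if T E = v then 1 else 0))) =
        (if S E = v then g v else 1) ^ z E / (if T E = v then g v else 1) ^ z E := by
      intro v
      rw [← div_zpow, mul_comm, zpow_mul, zpow_sub]
      split_ifs <;> simp
    simp_rw [h3, Finset.prod_div_distrib, Finset.prod_zpow]
    simp [div_zpow]
  have h4 : ∏ E, (c' E ^ z E / c E ^ z E) = 1 := by
    simp_rw [h1]
    rw [Finset.prod_comm]
    refine Finset.prod_eq_one fun v _ => ?_
    rw [← zpow_sum_eq_prod_zpow, hz, zpow_zero]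
  rw [Finset.prod_div_distrib, div_eq_one] at h4
  exact h4.symm

theorem exists_zpow_eq_of_isAlgClosed {k : Type u} [Field k] [IsAlgClosed k] {n : ℤ} (hn : n ≠ 0)
    (y : kˣ) : ∃ t : kˣ, t ^ n = y := by
  have key : ∀ (m : ℕ), 0 < m → ∀ y : kˣ, ∃ t : kˣ, t ^ m = y := by
    intro m hm y
    obtain ⟨t, ht⟩ := IsAlgClosed.exists_pow_nat_eq (y : k) hm
    have ht0 : t ≠ 0 := by
      rintro rfl
      rw [zero_pow hm.ne'] at ht
      exact y.ne_zero ht.symm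
    exact ⟨Units.mk0 t ht0, Units.ext ht⟩
  obtain ⟨m, rfl | rfl⟩ := n.eq_nat_or_neg
  · obtain ⟨t, ht⟩ := key m (by omega) y
    exact ⟨t, by rw [zpow_natCast, ht]⟩
  · obtain ⟨t, ht⟩ := key m (by omega) y⁻¹
    exact ⟨t, by rw [zpow_neg, zpow_natCast, ht, inv_inv]⟩

theorem infinite_units_of_isAlgClosed (k : Type u) [Field k] [IsAlgClosed k] : Infinite kˣ := by
  by_contra h
  rw [not_infinite_iff_finite] at h
  have : Finite k := by
    refine Set.finite_univ_iff.1 (((Set.finite_range (Units.val : kˣ → k)).insert 0).subset ?_)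
    intro x _
    by_cases hx : x = 0
    · exact Or.inl hx
    · exact Or.inr ⟨Units.mk0 x hx, rfl⟩
  exact not_finite k

end Weights

/-! ### Arrow matrices of square zero and their intertwiners. -/

section ArrowMatrix

variable {k : Type u} [Field k] {J : Type} [Fintype J] [DecidableEq J]

/-- The matrix on two copies of `J` with the entry `c j` at the place `(s j, t j)` of the upper
right block. -/
def arrowMatrix (s t : J → J) (c : J → k) : Matrix (Bool × J) (Bool × J) k :=
  ∑ j, Matrix.single (false, s j) (true, t j) (c j)

theorem arrowMatrix_mul_arrowMatrix (s t s' t' : J → J) (c c' : J → k) :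
    arrowMatrix s t c * arrowMatrix s' t' c' = 0 := by
  rw [arrowMatrix, arrowMatrix, Finset.sum_mul_sum]
  refine Finset.sum_eq_zero fun i _ => Finset.sum_eq_zero fun j _ => ?_
  exact Matrix.single_mul_single_of_ne _ _ _ _ (by simp) _

theorem diagonal_mul_arrowMatrix (d : Bool × J → k) (s t : J → J) (c : J → k) :
    Matrix.diagonal d * arrowMatrix s t c = arrowMatrix s t fun j => d (false, s j) * c j := by
  rw [arrowMatrix, arrowMatrix, Finset.mul_sum]
  refine Finset.sum_congr rfl fun j _ => ?_
  ext v w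
  rw [Matrix.diagonal_mul, Matrix.single_apply, Matrix.single_apply]
  split_ifs with h
  · rw [h.1]
  · rw [mul_zero]

theorem arrowMatrix_mul_diagonal (d : Bool × J → k) (s t : J → J) (c : J → k) :
    arrowMatrix s t c * Matrix.diagonal d = arrowMatrix s t fun j => c j * d (true, t j) := by
  rw [arrowMatrix, arrowMatrix, Finset.sum_mul]
  refine Finset.sum_congr rfl fun j _ => ?_
  ext v w
  rw [Matrix.mul_diagonal, Matrix.single_apply, Matrix.single_apply]
  split_ifs with h
  · rw [h.2]
  · rw [zero_mul]

theorem arrowMatrix_ite_eq (s t : J → J) (c : J → k) (j₀ : J) :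
    (arrowMatrix s t fun j => if j = j₀ then c j else 0) =
      Matrix.single (false, s j₀) (true, t j₀) (c j₀) := by
  rw [arrowMatrix, Finset.sum_eq_single j₀]
  · simp
  · intro j _ hj
    simp [hj]
  · simp

theorem Matrix.exists_col_ne_zero {W : Type} [Fintype W] [DecidableEq W] {φ : Matrix W W k}
    (hφ : IsUnit φ) (w : W) : ∃ v, φ v w ≠ 0 := by
  obtain ⟨ψ, hψ⟩ := hφ.exists_left_inv
  by_contra! h
  have := congrFun (congrFun hψ w) w
  simp [Matrix.mul_apply, h] at this

theorem Matrix.exists_row_ne_zero {W : Type} [Fintype W] [DecidableEq W] {φ : Matrix W W k}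
    (hφ : IsUnit φ) (v : W) : ∃ w, φ v w ≠ 0 := by
  obtain ⟨ψ, hψ⟩ := hφ.exists_right_inv
  by_contra! h
  have := congrFun (congrFun hψ v) v
  simp [Matrix.mul_apply, h] at this

/-- An invertible matrix that commutes with the idempotents and intertwines two systems of arrow
matrices with invertible weights induces a rescaling of the weights. -/
theorem exists_rescaling {S T : Bool × J → Bool × J}
    (hST : ∀ p, (∃ E, S E = (false, p)) ∨ ∃ E, T E = (true, p))
    {φ : Matrix (Bool × J) (Bool × J) k} (hφ : IsUnit φ)
    (hdiag : ∀ p : J, φ * Matrix.diagonal (fun w => if w.2 = p then 1 else 0) =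
      Matrix.diagonal (fun w => if w.2 = p then 1 else 0) * φ)
    {c c' : Bool × J → kˣ}
    (hsingle : ∀ E, φ * Matrix.single (S E) (T E) (c E : k) =
      Matrix.single (S E) (T E) (c' E : k) * φ) :
    ∃ g : Bool × J → kˣ, ∀ E, g (S E) * c E = c' E * g (T E) := by
  -- Commuting with the idempotents confines `φ` to the 2 × 2 blocks on `(false, p)` and `(true,
  -- p)`.
  have hblock : ∀ v w, v.2 ≠ w.2 → φ v w = 0 := by
    intro v w hvw
    have := congrFun (congrFun (hdiag v.2) v) w
    simpa [Matrix.mul_diagonal, Matrix.diagonal_mul, hvw.symm] using this.symm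
  -- An edge at `(false, p)` or `(true, p)` makes the block triangular: one side of the intertwining
  -- relation vanishes since edges start only in copy `false` and end only in copy `true`.
  have hlower : ∀ p, φ (true, p) (false, p) = 0 := by
    intro p
    rcases hST p with ⟨E, hE⟩ | ⟨E, hE⟩
    · have := congrFun (congrFun (hsingle E) (true, p)) (T E)
      rw [Matrix.mul_single_apply_same, Matrix.single_mul_apply_of_ne _ _ _ _ _ (by simp [hE]),
        hE] at this
      exact (mul_eq_zero.1 this).resolve_right (c E).ne_zero
    · have := congrFun (congrFun (hsingle E) (S E)) (false, p)
      rw [Matrix.single_mul_apply_same, Matrix.mul_single_apply_of_ne _ _ _ _ _ (by simp [hE]),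
        hE] at this
      exact (mul_eq_zero.1 this.symm).resolve_left (c' E).ne_zero
  -- In an invertible triangular block the diagonal entries are nonzero: copy `false` uses its
  -- column, copy `true` its row.
  have hne : ∀ w, φ w w ≠ 0 := by
    rintro ⟨b, p⟩ h
    cases b with
    | false =>
      obtain ⟨⟨b, q⟩, hv⟩ := Matrix.exists_col_ne_zero hφ (false, p)
      by_cases hqp : q = p
      · subst hqp
        cases b
        exacts [hv h, hv (hlower q)]
      · exact hv (hblock _ _ hqp)
    | true =>
      obtain ⟨⟨b, q⟩, hv⟩ := Matrix.exists_row_ne_zero hφ (true, p)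
      by_cases hqp : p = q
      · subst hqp
        cases b
        exacts [hv (hlower p), hv h]
      · exact hv (hblock _ _ hqp)
  refine ⟨fun w => Units.mk0 _ (hne w), fun E => Units.ext ?_⟩
  have := congrFun (congrFun (hsingle E) (S E)) (T E)
  rw [Matrix.mul_single_apply_same, Matrix.single_mul_apply_same] at this
  exact this

end ArrowMatrix

/-! ### Arrow families obtained from cycles. -/

/-- A family of distinct vertices and distinct arrows of the quiver `V`, both indexed by `ι`, such
that the ends of each arrow belong to the family and the arrow `edge i` is incident with the vertex
`vert i`. -/
structure ArrowFamily (V : Type v) [Quiver.{w} V] (ι : Type) where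
  vert : ι → V
  edge : ι → Quiver.Total V
  src : ι → ι
  tgt : ι → ι
  vert_injective : Function.Injective vert
  edge_injective : Function.Injective edge
  left_edge : ∀ i, (edge i).left = vert (src i)
  right_edge : ∀ i, (edge i).right = vert (tgt i)
  incident : ∀ i, src i = i ∨ tgt i = i

/-- Orientation along the cycle is irrelevant: either way `e i` has `x i` as one end. -/
theorem UnderlyingGraphHasCycle.exists_arrowFamily {V : Type v} [Quiver.{w} V]
    (h : UnderlyingGraphHasCycle V) : ∃ n : ℕ, Nonempty (ArrowFamily V (Fin (n + 1))) := by
  obtain ⟨n, x, e, hx, he, hxe⟩ := h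
  have key : ∀ i, ∃ s t, (e i).left = x s ∧ (e i).right = x t ∧ (s = i ∨ t = i) := fun i =>
    (hxe i).elim (fun h => ⟨i, i + 1, h.1, h.2, Or.inl rfl⟩)
      fun h => ⟨i + 1, i, h.1, h.2, Or.inr rfl⟩
  choose s t hs ht hst using key
  exact ⟨n, ⟨x, e, s, t, hx, he, hs, ht, hst⟩⟩

namespace ArrowFamily

variable {k : Type u} [Field k] {V : Type v} [Quiver.{w} V] [Fintype V] {ι : Type}
  {J : Type} [Fintype J] [DecidableEq J]

open Classical in
/-- The representation on two copies of `J`, a set over the index set of the arrow family, in which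
the arrows act by weighted matrix units from one copy to the other. -/
noncomputable def matrixRep (F : ArrowFamily V ι) (π : J → ι) (s t : J → J)
    (hs : ∀ j, π (s j) = F.src (π j)) (ht : ∀ j, π (t j) = F.tgt (π j)) (c : J → k) :
    QuiverRepIn V (Matrix (Bool × J) (Bool × J) k) where
  vert a := Matrix.diagonal fun w => if F.vert (π w.2) = a then 1 else 0
  arr e := arrowMatrix s t fun j => if F.edge (π j) = e then c j else 0
  vert_mul_self a := by
    rw [Matrix.diagonal_mul_diagonal]
    congr 1
    ext w
    simp
  vert_mul_of_ne a b hab := by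
    rw [Matrix.diagonal_mul_diagonal, ← Matrix.diagonal_zero]
    congr 1
    ext w
    split_ifs with h₁ h₂
    · exact absurd (h₁.symm.trans h₂) hab
    all_goals simp
  sum_vert := by
    ext v w
    rw [Matrix.sum_apply, Matrix.one_apply]
    simp only [Matrix.diagonal_apply]
    split_ifs with h
    · simp
    · simp
  left_mul e := by
    rw [diagonal_mul_arrowMatrix]
    congr 1
    ext j
    dsimp only
    by_cases h : F.edge (π j) = e
    · rw [hs, ← F.left_edge, h, if_pos rfl, one_mul]
    · rw [if_neg h, mul_zero]
  mul_right e := by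
    rw [arrowMatrix_mul_diagonal]
    congr 1
    ext j
    dsimp only
    by_cases h : F.edge (π j) = e
    · rw [ht, ← F.right_edge, h, if_pos rfl, if_pos rfl, mul_one]
    · rw [if_neg h, zero_mul]

theorem matrixRep_arr_mul_arr (F : ArrowFamily V ι) (π : J → ι) (s t : J → J)
    (hs : ∀ j, π (s j) = F.src (π j)) (ht : ∀ j, π (t j) = F.tgt (π j)) (c : J → k)
    (e e' : Quiver.Total V) :
    (F.matrixRep π s t hs ht c).arr e * (F.matrixRep π s t hs ht c).arr e' = 0 :=
  arrowMatrix_mul_arrowMatrix _ _ _ _ _ _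

end ArrowFamily

/-! ### The weighted representations of the tensor product. -/

section Product

open PathAlgebra

variable {k : Type u} [Field k]
  {QA : Type v₁} [Quiver.{w₁} QA] [Fintype QA] {QB : Type v₂} [Quiver.{w₂} QB] [Fintype QB]
  {ι κ : Type} [Fintype ι] [DecidableEq ι] [Fintype κ] [DecidableEq κ]
  (F : ArrowFamily QA ι) (G : ArrowFamily QB κ)

/-- The action of the first factor. -/
noncomputable def leftRep (c : Bool × ι × κ → kˣ) :
    QuiverRepIn QA (Matrix (Bool × ι × κ) (Bool × ι × κ) k) :=
  F.matrixRep Prod.fst (fun p => (F.src p.1, p.2)) (fun p => (F.tgt p.1, p.2))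
    (fun _ => rfl) (fun _ => rfl) fun p => c (false, p)

/-- The action of the second factor. -/
noncomputable def rightRep (c : Bool × ι × κ → kˣ) :
    QuiverRepIn QB (Matrix (Bool × ι × κ) (Bool × ι × κ) k) :=
  G.matrixRep Prod.snd (fun p => (p.1, G.src p.2)) (fun p => (p.1, G.tgt p.2))
    (fun _ => rfl) (fun _ => rfl) fun p => c (true, p)

theorem leftRep_arr_mul_arr (c : Bool × ι × κ → kˣ) (e e' : Quiver.Total QA) :
    (leftRep F c).arr e * (leftRep F c).arr e' = 0 :=
  F.matrixRep_arr_mul_arr _ _ _ _ _ _ _ _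

theorem rightRep_arr_mul_arr (c : Bool × ι × κ → kˣ) (e e' : Quiver.Total QB) :
    (rightRep G c).arr e * (rightRep G c).arr e' = 0 :=
  G.matrixRep_arr_mul_arr _ _ _ _ _ _ _ _

/-- An arrow of one factor preserves the coordinate on which the idempotents of the other depend.
Two arrows from different factors have product zero in both orders, so no condition on the weights
around a square arises. -/
theorem commute_lift_leftRep_rightRep (c : Bool × ι × κ → kˣ) (x : PathAlgebra k QA)
    (y : PathAlgebra k QB) : Commute ((leftRep F c).lift k x) ((rightRep G c).lift k y) := by
  refine QuiverRepIn.commute_lift _ (fun a => ?_) (fun e => ?_) x <;>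
    refine (QuiverRepIn.commute_lift _ (fun b => ?_) (fun e' => ?_) y).symm
  · exact Matrix.commute_diagonal _ _
  · change _ * _ = _ * _
    simp only [leftRep, rightRep, ArrowFamily.matrixRep, diagonal_mul_arrowMatrix,
      arrowMatrix_mul_diagonal, mul_comm]
  · change _ * _ = _ * _
    simp only [leftRep, rightRep, ArrowFamily.matrixRep, diagonal_mul_arrowMatrix,
      arrowMatrix_mul_diagonal, mul_comm]
  · change _ * _ = _ * _
    simp only [leftRep, rightRep, ArrowFamily.matrixRep, arrowMatrix_mul_arrowMatrix]

variable (IA : Ideal (PathAlgebra k QA)) [IA.IsTwoSided] (IB : Ideal (PathAlgebra k QB))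
  [IB.IsTwoSided] (hIA : IA ≤ arrowIdeal k QA ^ 2) (hIB : IB ≤ arrowIdeal k QB ^ 2)

open scoped TensorProduct

/-- The matrix representation of the tensor product of two bound quiver algebras with weights `c`
on the arrows `edge i × vert j` and `vert i × edge j` of the product quiver. -/
noncomputable def productRep (c : Bool × ι × κ → kˣ) :
    ((PathAlgebra k QA ⧸ IA) ⊗[k] (PathAlgebra k QB ⧸ IB)) →ₐ[k]
      Matrix (Bool × ι × κ) (Bool × ι × κ) k :=
  Algebra.TensorProduct.lift
    ((leftRep F c).liftQuotient (leftRep_arr_mul_arr F c) IA hIA)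
    ((rightRep G c).liftQuotient (rightRep_arr_mul_arr G c) IB hIB)
    (by
      intro x y
      obtain ⟨x, rfl⟩ := Ideal.Quotient.mk_surjective x
      obtain ⟨y, rfl⟩ := Ideal.Quotient.mk_surjective y
      exact commute_lift_leftRep_rightRep F G c x y)

theorem productRep_tmul (c : Bool × ι × κ → kˣ) (x : PathAlgebra k QA) (y : PathAlgebra k QB) :
    productRep F G IA IB hIA hIB c (Ideal.Quotient.mk IA x ⊗ₜ Ideal.Quotient.mk IB y) =
      (leftRep F c).lift k x * (rightRep G c).lift k y :=
  Algebra.TensorProduct.lift_tmul _ _ _ _ _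

theorem productRep_idem_tmul_idem (c : Bool × ι × κ → kˣ) (p : ι × κ) :
    productRep F G IA IB hIA hIB c
      (Ideal.Quotient.mk IA (idem k (F.vert p.1)) ⊗ₜ Ideal.Quotient.mk IB (idem k (G.vert p.2))) =
      Matrix.diagonal fun w => if w.2 = p then 1 else 0 := by
  rw [productRep_tmul, QuiverRepIn.lift_idem, QuiverRepIn.lift_idem]
  simp only [leftRep, rightRep, ArrowFamily.matrixRep, Matrix.diagonal_mul_diagonal]
  congr 1
  ext w
  simp only [F.vert_injective.eq_iff, G.vert_injective.eq_iff, Prod.ext_iff, ite_and]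
  split_ifs <;> simp

/-- Distinctness of the arrows of `F` and of the vertices of `G` isolates one edge of the separated
quiver, so every weight can be read off individually. -/
theorem productRep_arrow_tmul_idem (c : Bool × ι × κ → kˣ) (p : ι × κ) :
    productRep F G IA IB hIA hIB c
      (Ideal.Quotient.mk IA (arrow k (F.edge p.1)) ⊗ₜ Ideal.Quotient.mk IB (idem k (G.vert p.2))) =
      Matrix.single (false, (F.src p.1, p.2)) (true, (F.tgt p.1, p.2)) (c (false, p) : k) := by
  rw [productRep_tmul, QuiverRepIn.lift_idem, QuiverRepIn.lift_arrow]
  simp only [leftRep, rightRep, ArrowFamily.matrixRep, arrowMatrix_mul_diagonal]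
  rw [← arrowMatrix_ite_eq (fun p : ι × κ => (F.src p.1, p.2)) (fun p => (F.tgt p.1, p.2))
    (fun p => (c (false, p) : k))]
  congr 1
  ext q
  simp only [F.edge_injective.eq_iff, G.vert_injective.eq_iff, Prod.ext_iff, ite_and]
  split_ifs <;> simp

theorem productRep_idem_tmul_arrow (c : Bool × ι × κ → kˣ) (p : ι × κ) :
    productRep F G IA IB hIA hIB c
      (Ideal.Quotient.mk IA (idem k (F.vert p.1)) ⊗ₜ Ideal.Quotient.mk IB (arrow k (G.edge p.2))) =
      Matrix.single (false, (p.1, G.src p.2)) (true, (p.1, G.tgt p.2)) (c (true, p) : k) := by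
  rw [productRep_tmul, QuiverRepIn.lift_idem, QuiverRepIn.lift_arrow]
  simp only [leftRep, rightRep, ArrowFamily.matrixRep, diagonal_mul_arrowMatrix]
  rw [← arrowMatrix_ite_eq (fun p : ι × κ => (p.1, G.src p.2)) (fun p => (p.1, G.tgt p.2))
    (fun p => (c (true, p) : k))]
  congr 1
  ext q
  simp only [F.vert_injective.eq_iff, G.edge_injective.eq_iff, Prod.ext_iff, ite_and]
  split_ifs <;> simp

/-- The start of an edge of the separated quiver of the product. -/
def productSource (E : Bool × ι × κ) : Bool × ι × κ :=
  (false, bif E.1 then (E.2.1, G.src E.2.2) else (F.src E.2.1, E.2.2))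

/-- The end of an edge of the separated quiver of the product. -/
def productTarget (E : Bool × ι × κ) : Bool × ι × κ :=
  (true, bif E.1 then (E.2.1, G.tgt E.2.2) else (F.tgt E.2.1, E.2.2))

theorem exists_rescaling_of_iso {c c' : Bool × ι × κ → kˣ}
    (h : Nonempty (matrixModule (productRep F G IA IB hIA hIB c) ≅
      matrixModule (productRep F G IA IB hIA hIB c'))) :
    ∃ g : Bool × ι × κ → kˣ,
      ∀ E, g (productSource F G E) * c E = c' E * g (productTarget F G E) := by
  obtain ⟨φ, hφ, hcomm⟩ := exists_intertwiner h
  refine exists_rescaling (fun p => ?_) hφ (fun p => ?_) fun E => ?_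
  · rcases F.incident p.1 with hp | hp
    · exact Or.inl ⟨(false, p), by simp [productSource, hp]⟩
    · exact Or.inr ⟨(false, p), by simp [productTarget, hp]⟩
  · have := hcomm (Ideal.Quotient.mk IA (idem k (F.vert p.1)) ⊗ₜ
      Ideal.Quotient.mk IB (idem k (G.vert p.2)))
    rwa [productRep_idem_tmul_idem, productRep_idem_tmul_idem] at this
  · obtain ⟨_ | _, p⟩ := E
    · have := hcomm (Ideal.Quotient.mk IA (arrow k (F.edge p.1)) ⊗ₜ
        Ideal.Quotient.mk IB (idem k (G.vert p.2)))
      rwa [productRep_arrow_tmul_idem, productRep_arrow_tmul_idem] at this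
    · have := hcomm (Ideal.Quotient.mk IA (idem k (F.vert p.1)) ⊗ₜ
        Ideal.Quotient.mk IB (arrow k (G.edge p.2)))
      rwa [productRep_idem_tmul_arrow, productRep_idem_tmul_arrow] at this

end Product

/-! ### Infinitely many modules of one dimension. -/

open PathAlgebra ModuleCat.Algebra TensorProduct in
theorem not_isRepresentationFinite_of_arrowFamily {k : Type u} [Field k] [IsAlgClosed k]
    {QA : Type v₁} [Quiver.{w₁} QA] [Fintype QA] {QB : Type v₂} [Quiver.{w₂} QB] [Fintype QB]
    {ι κ : Type} [Fintype ι] [DecidableEq ι] [Fintype κ] [DecidableEq κ] [Nonempty ι] [Nonempty κ]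
    (F : ArrowFamily QA ι) (G : ArrowFamily QB κ) (IA : Ideal (PathAlgebra k QA)) [IA.IsTwoSided]
    (IB : Ideal (PathAlgebra k QB)) [IB.IsTwoSided] (hIA : IA ≤ arrowIdeal k QA ^ 2)
    (hIB : IB ≤ arrowIdeal k QB ^ 2) :
    ¬ IsRepresentationFinite k ((PathAlgebra k QA ⧸ IA) ⊗[k] (PathAlgebra k QB ⧸ IB)) := by
  intro hfin
  obtain ⟨T, hT, hTd⟩ := hfin.exists_finite_of_finrank_le (Fintype.card (Bool × ι × κ))
  obtain ⟨z, hz, hflow⟩ := exists_ne_zero_flow (productSource F G) (productTarget F G)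
  obtain ⟨E₀, hE₀⟩ := Function.ne_iff.1 hz
  choose r hr using exists_zpow_eq_of_isAlgClosed (k := k) hE₀
  -- The weight is `1` except at `E₀`, where `z E₀ ≠ 0`; there it is a `z E₀`-th root of `y`, so the
  -- invariant equals `y`.
  let M (y : kˣ) := matrixModule (productRep F G IA IB hIA hIB (Pi.mulSingle E₀ (r y)))
  have hM : ∀ y, ∃ N : T, Nonempty (M y ≅ N) := by
    intro y
    let e := matrixModuleEquiv (productRep F G IA IB hIA hIB (Pi.mulSingle E₀ (r y)))
    obtain ⟨N, hN, hMN⟩ := hTd (M y) (Module.Finite.equiv e.symm)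
      (by rw [e.finrank_eq, Module.finrank_fintype_fun_eq_card])
    exact ⟨⟨N, hN⟩, hMN⟩
  choose N hN using hM
  have := infinite_units_of_isAlgClosed k
  have := hT.to_subtype
  -- Pigeonhole: two different invariants would belong to the same isomorphism class.
  obtain ⟨y, y', hne, hyy⟩ := Finite.exists_ne_map_eq_of_infinite N
  obtain ⟨f⟩ := hN y
  obtain ⟨f'⟩ := hN y'
  rw [← hyy] at f'
  obtain ⟨g, hg⟩ := exists_rescaling_of_iso F G IA IB hIA hIB ⟨f ≪≫ f'.symm⟩
  have hprod : ∀ y, ∏ E, (Pi.mulSingle E₀ (r y) : Bool × ι × κ → kˣ) E ^ z E = y := by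
    intro y
    rw [Finset.prod_eq_single E₀, Pi.mulSingle_eq_same, hr]
    · intro E _ hE
      rw [Pi.mulSingle_eq_of_ne hE, one_zpow]
    · simp
  have := prod_zpow_eq_of_flow hflow hg
  rw [hprod, hprod] at this
  exact hne this

open scoped TensorProduct in
theorem mainTheorem2 {k : Type u} [Field k] [IsAlgClosed k]
    {QA : Type v₁} [Quiver.{w₁} QA] [Fintype QA] [∀ i j : QA, Finite (i ⟶ j)]
    {QB : Type v₂} [Quiver.{w₂} QB] [Fintype QB] [∀ i j : QB, Finite (i ⟶ j)]
    (hQA : QuiverConnected QA) (hQB : QuiverConnected QB)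
    (IA : Ideal (PathAlgebra k QA)) [IA.IsTwoSided] (hIA : PathAlgebra.IsAdmissible IA)
    (IB : Ideal (PathAlgebra k QB)) [IB.IsTwoSided] (hIB : PathAlgebra.IsAdmissible IB)
    (hA : UnderlyingGraphHasCycle QA) (hB : UnderlyingGraphHasCycle QB) :
    ¬ IsRepresentationFinite k ((PathAlgebra k QA ⧸ IA) ⊗[k] (PathAlgebra k QB ⧸ IB)) := by
  obtain ⟨n, ⟨F⟩⟩ := hA.exists_arrowFamily
  obtain ⟨m, ⟨G⟩⟩ := hB.exists_arrowFamily
  exact not_isRepresentationFinite_of_arrowFamily F G IA IB hIA.le_sq hIB.le_sq
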